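/- Let $\overline{\mathcal S}$ be the set of mass-partitions, i.e. decreasing sequences $s=(s_1,s_2,\dots)$ of non-negative reals with $\sum_i s_i\le 1$. For $0\le\alpha<1$ and $\theta>-\alpha$, let $PD(\alpha,\theta)$ be the Poisson–Dirichlet law: the law of the decreasing rearrangement of the sequence $(1-Y_1)\cdots(1-Y_{n-1})Y_n$, $n\ge 1$, where the $Y_n$ are independent and $Y_n$ has the beta law with parameters $(1-\alpha,\theta+n\alpha)$. For $s\in\overline{\mathcal S}$ let $\rho_s$ be the law of the paint-box of $s$, the random partition of $\mathbb N=\{1,2,\dots\}$ in which $i\ne j$ are in the same block iff $U_i$ and $U_j$ lie in the same interval $[s_1+\dots+s_{k-1},\,s_1+\dots+s_k)$ for some $k\ge 1$, with $U_1,U_2,\dots$ independent and uniform on $[0,1]$; for a measure $\nu$ on $\overline{\mathcal S}$ put $\rho_\nu=\int\rho_s\,\nu(ds)$. Let $\varepsilon$ be the sum over $i\in\mathbb N$ of the Dirac masses at the partitions $\{\{i\},\mathbb N\setminus\{i\}\}$. Ruelle's fragmentation is the time-inhomogeneous fragmentation on $[0,1)$ in which, between times $t$ and $t+h$, every fragment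 is split independently according to $PD(t+h,-t)$. For $t\in[0,1)$ and a partition $\pi$ of $\{1,\dots,n\}$ with at least two blocks, the jump rate at time $t$ to $\pi$ of the associated process of partitions restricted to $\{1,\dots,n\}$, starting from the one-block partition, is $$q_{\pi,t}=\lim_{h\to0^+}\frac1h\,\rho_{PD(t+h,-t)}\big(\{\pi' : \pi'_{|\{1,\dots,n\}}=\pi\}\big).$$ Its instantaneous dislocation measure at time $t$ is the measure $\nu_t$ on $\overline{\mathcal S}$ such that $\nu_t(\{(1,0,0,\dots)\})=0$, $\int(1-s_1)\,\nu_t(ds)<\infty$ and, for some erosion coefficient $c_t\ge0$, $(\rho_{\nu_t}+c_t\varepsilon)(\{\pi' : \pi'_{|\{1,\dots,n\}}=\pi\})=q_{\pi,t}$ for all $n$ and all partitions $\pi$ of $\{1,\dots,n\}$ with at least two blocks. Let $K$ be a Poisson measure on $[0,1)\times\overline{\mathcal S}\times\mathbb N$ with intensity $\nu_t(ds)\,dt\otimes\sharp$, where $\sharp$ is the counting measure on $\mathbb N$, and for $t\in(0,1)$ let $$R(t)=\sup\{s_2 : (u,s,1)\text{ is an atom of }K\text{ with }u\le t\}.$$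 **Proposition.** Fix $T_0\in(0,1/2)$. There are constants $C_1,C_2,C_3>0$ such that, for all $\lambda>0$ and all $t\in(0,T_0)$, $$\exp(-C_1\lambda-C_3t)\le\mathbb P\big(R(t)\le e^{-\lambda/t}\big)\le\exp(-C_2\lambda+C_3t).$$ -/

import Mathlib

open MeasureTheory ProbabilityTheory Filter Topology Set
open scoped ENNReal NNReal

namespace Ruelle

/-! ### Mass-partitions -/

/-- Decreasing sequences of non-negative reals with total mass at most one (all partial sums at
most one). Indices start at `0`: `s 0` is the largest term and `s 1` the second largest one. -/
def IsMassPartition (s : ℕ → ℝ) : Prop :=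
  Antitone s ∧ (∀ i, 0 ≤ s i) ∧ ∀ n, ∑ i ∈ Finset.range n, s i ≤ 1

/-- The set of mass-partitions. Its sigma-algebra, generated by the coordinates, is also the Borel
sigma-algebra of the uniform distance. -/
def MassPartition : Type := {s : ℕ → ℝ // IsMassPartition s}

instance : MeasurableSpace MassPartition :=
  inferInstanceAs (MeasurableSpace {s : ℕ → ℝ // IsMassPartition s})

/-- The trivial mass-partition `(1, 0, 0, …)`. -/
def MassPartition.one : MassPartition :=
  ⟨fun i => if i = 0 then 1 else 0, by
    refine ⟨fun i j hij => ?_, fun i => ?_, fun n => ?_⟩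
    · dsimp only
      split_ifs <;> first | omega | norm_num
    · dsimp only
      split_ifs <;> norm_num
    · rw [Finset.sum_ite_eq']
      split_ifs <;> norm_num⟩

open Classical in
/-- A mass-partition seen as such; sequences that are not mass-partitions are sent to the trivial
one (a convention that only concerns null sets below). -/
noncomputable def MassPartition.ofSeq (s : ℕ → ℝ) : MassPartition :=
  if h : IsMassPartition s then ⟨s, h⟩ else MassPartition.one

/-! ### Poisson-Dirichlet laws -/

/-- Stick-breaking: the `n`-th term is `(1 - Y 0) ⋯ (1 - Y (n - 1)) * Y n`. -/
noncomputable def stickBreaking (Y : ℕ → ℝ) (n : ℕ) : ℝ :=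
  (∏ i ∈ Finset.range n, (1 - Y i)) * Y n

/-- Decreasing rearrangement of a bounded non-negative sequence: the `n`-th term, counted from
`0`, is the supremum over all sets of `n + 1` indices of the smallest value on that set. -/
noncomputable def ranked (f : ℕ → ℝ) (n : ℕ) : ℝ :=
  ⨆ F : {F : Finset ℕ // F.card = n + 1},
    F.1.inf' (Finset.card_pos.1 (F.2.symm ▸ Nat.succ_pos n)) f

/-- The Poisson-Dirichlet law `PD(α, θ)`: the law of the decreasing rearrangement of the
stick-breaking sequence of independent variables `Y₁, Y₂, …` where `Yₙ` has the beta law with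
parameters `1 - α` and `θ + n α`. -/
noncomputable def poissonDirichlet (α θ : ℝ) : Measure MassPartition :=
  (Measure.infinitePi fun n : ℕ => betaMeasure (1 - α) (θ + (n + 1) * α)).map
    fun Y => MassPartition.ofSeq (ranked (stickBreaking Y))

/-- The map defining the Poisson-Dirichlet laws is measurable, so that these are genuine image
measures. -/
theorem measurable_ofSeq_ranked_stickBreaking :
    Measurable fun Y : ℕ → ℝ => MassPartition.ofSeq (ranked (stickBreaking Y)) := by
  have h1 : Measurable stickBreaking := by
    unfold stickBreaking
    fun_prop
  have h2 : Measurable ranked := by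
    refine measurable_pi_lambda _ fun n => ?_
    unfold ranked
    refine Measurable.iSup fun F => ?_
    have : Measurable (F.1.inf' (Finset.card_pos.1 (F.2.symm ▸ Nat.succ_pos n))
        (fun i (f : ℕ → ℝ) => f i)) :=
      Finset.inf'_induction _ _ (fun _ h _ h' => h.inf h') fun i _ => measurable_pi_apply i
    convert this using 1
    ext f
    simp [Finset.inf'_apply]
  have h3 : MeasurableSet {s : ℕ → ℝ | IsMassPartition s} := by
    have : {s : ℕ → ℝ | IsMassPartition s} = (⋂ i, {s | s (i + 1) ≤ s i}) ∩
        ((⋂ i, {s | 0 ≤ s i}) ∩ ⋂ n, {s | ∑ i ∈ Finset.range n, s i ≤ 1}) := by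
      ext s
      simp only [IsMassPartition, mem_ofPred_eq, mem_inter_iff, mem_iInter]
      exact and_congr_left fun _ => ⟨fun h i => h (Nat.le_succ i), antitone_nat_of_succ_le⟩
    rw [this]
    refine (MeasurableSet.iInter fun i => ?_).inter
      ((MeasurableSet.iInter fun i => ?_).inter (MeasurableSet.iInter fun n => ?_))
    · exact measurableSet_le (measurable_pi_apply _) (measurable_pi_apply _)
    · exact measurableSet_le measurable_const (measurable_pi_apply _)
    · exact measurableSet_le (by fun_prop) measurable_const
  have h4 : Measurable MassPartition.ofSeq := by
    classical
    refine Measurable.dite (s := {s | IsMassPartition s}) (f := fun s => ⟨s.1, s.2⟩)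
      (g := fun _ => MassPartition.one) ?_ measurable_const h3
    exact Measurable.subtype_mk measurable_subtype_coe
  exact h4.comp (h2.comp h1)

/-! ### Paint-boxes and exchangeable measures on partitions

A partition of `{1, …, n}` is an equivalence relation on `Fin n`, and the partition with one
block is `⊤`. -/

/-- The interval of the paint-box of `s` attached to its term of index `k`. -/
def MassPartition.interval (s : MassPartition) (k : ℕ) : Set ℝ :=
  Ico (∑ i ∈ Finset.range k, s.1 i) (∑ i ∈ Finset.range (k + 1), s.1 i)

/-- The probability that the paint-box of `s` induces the partition `π` of `{1, …, n}`: draw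
independent uniform variables `U i` on `[0, 1]`, two distinct integers `i`, `j` being in the same
block when `U i` and `U j` fall in the same interval of `s`. -/
noncomputable def paintBox (s : MassPartition) {n : ℕ} (π : Setoid (Fin n)) : ℝ≥0∞ :=
  Measure.pi (fun _ : Fin n => (volume : Measure ℝ).restrict (Icc 0 1))
    {U | ∀ i j, π i j ↔ i = j ∨ ∃ k, U i ∈ s.interval k ∧ U j ∈ s.interval k}

/-- The mass given by the exchangeable measure `∫ ρ_s(·) ν(ds)`, with `ρ_s` the law of the
paint-box of `s`, to the partitions of the positive integers whose restriction to `{1, …, n}`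
is `π`. -/
noncomputable def paintBoxMass (ν : Measure MassPartition) {n : ℕ} (π : Setoid (Fin n)) : ℝ≥0∞ :=
  ∫⁻ s, paintBox s π ∂ν

/-- For `π ≠ ⊤`, the mass given by the erosion measure, the sum over all positive integers `i` of
the Dirac masses at the partitions into `{i}` and its complement, to the partitions whose
restriction to `{1, …, n}` is `π` (an integer `i > n` restricts to `⊤`). -/
noncomputable def erosionMass {n : ℕ} (π : Setoid (Fin n)) : ℕ :=
  {i : Fin n | ∀ a b, π a b ↔ (a = i ↔ b = i)}.ncard

/-! ### Ruelle's fragmentation and its dislocation measures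

Ruelle's fragmentation `(F(t), t ∈ [0, 1[)` is the time-inhomogeneous fragmentation in which,
between times `t` and `t + h`, every fragment is split independently according to the law
`PD(t + h, -t)`. In the associated process of exchangeable partitions the block `{1, …, n}`, if
still present at time `t`, has therefore been turned into `π` at time `t + h` with probability
`paintBoxMass (poissonDirichlet (t + h) (-t)) π`. -/

/-- `q` is the jump rate at time `t`, from the partition with one block to `π`, of the restriction
to `{1, …, n}` of Ruelle's fragmentation. -/
def IsJumpRate (t : ℝ) {n : ℕ} (π : Setoid (Fin n)) (q : ℝ≥0∞) : Prop :=
  Tendsto (fun h : ℝ => paintBoxMass (poissonDirichlet (t + h) (-t)) π / ENNReal.ofReal h)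
    (𝓝[>] 0) (𝓝 q)

/-- `ν` is the instantaneous dislocation measure at time `t` of Ruelle's fragmentation: a measure
on mass-partitions that does not charge `(1, 0, 0, …)`, integrates `1 - s₁`, and such that for
some erosion coefficient `c ≥ 0` the exchangeable measure `∫ ρ_s(·) ν(ds) + c ε`, where `ε` is
the erosion measure, gives the jump rates of the process at time `t`. -/
structure IsDislocationMeasure (t : ℝ) (ν : Measure MassPartition) : Prop where
  one_null : ν {MassPartition.one} = 0
  integrable : ∫⁻ s, ENNReal.ofReal (1 - s.1 0) ∂ν < ∞
  rate : ∃ c : ℝ≥0, ∀ (n : ℕ) (π : Setoid (Fin n)), π ≠ ⊤ →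
    IsJumpRate t π (paintBoxMass ν π + c * erosionMass π)

/-! ### The Poisson measure of dislocations and its record process -/

/-- `K` is a Poisson measure with intensity `Λ`, given by its random countable set of atoms: the
numbers of atoms in disjoint measurable sets are independent, and the number of atoms in a
measurable set `A` has the Poisson law of parameter `Λ A` (and is almost surely infinite when
`Λ A = ∞`). -/
structure IsPoissonMeasure {Ω E : Type*} [MeasurableSpace Ω] [MeasurableSpace E]
    (P : Measure Ω) (K : Ω → Set E) (Λ : Set E → ℝ≥0∞) : Prop where
  countable : ∀ ω, (K ω).Countable
  measurable : ∀ A, MeasurableSet A → Measurable fun ω => (K ω ∩ A).encard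
  law : ∀ A, MeasurableSet A → Λ A ≠ ∞ →
    ∀ n : ℕ, P {ω | (K ω ∩ A).encard = n} = poissonMeasure (Λ A).toNNReal {n}
  law_top : ∀ A, MeasurableSet A → Λ A = ∞ → ∀ᵐ ω ∂P, (K ω ∩ A).encard = ⊤
  indep : ∀ (m : ℕ) (A : Fin m → Set E), (∀ i, MeasurableSet (A i)) →
    Pairwise (fun i j => Disjoint (A i) (A j)) →
    iIndepFun (fun i ω => (K ω ∩ A i).encard) P

/-- The intensity `ν_t(ds) dt ⊗ ♯` on `[0, 1[ × MassPartition × ℕ`, with `♯` the counting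
measure. -/
noncomputable def dislocationIntensity (ν : ℝ → Measure MassPartition)
    (A : Set (ℝ × MassPartition × ℕ)) : ℝ≥0∞ :=
  ∫⁻ t in Ico (0 : ℝ) 1, ∑' k : ℕ, ν t {s | (t, s, k) ∈ A}

/-- The record `R(t)`: the largest second term `s₂` among the atoms `(u, s, k)` with `u ≤ t` that
dislocate the largest fragment, whose label is `k = 0` since labels start at `0`. -/
noncomputable def record (K : Set (ℝ × MassPartition × ℕ)) (t : ℝ) : ℝ :=
  sSup {x | ∃ u ∈ Icc 0 t, ∃ s : MassPartition, (u, s, 0) ∈ K ∧ x = s.1 1}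

end Ruelle

namespace Ruelle

/-! ### Moments of beta laws -/

/-! The record stays below ε up to time t exactly when the Poisson measure has no atom with label 0,
time at most t and s₂ > ε (here s₁ is `s.1 0` and s₂ is `s.1 1`). This void probability is exp(-∫₀ᵗ
ν_u(s₂ > ε) du). With ε = e^{-L} and L = l/t, it is enough to show L/320 - 2 ≤ ν_u(s₂ > e^{-L}) ≤ 4L
+ 12 for every u < 1/2, and then to integrate over u.

No formula for ν_u is needed: both bounds come from the jump rates, themselves controlled by the
first one or two sticks of PD(u + h, -u) as h → 0.

Upper bound (`measure_lt_second_le`): the total rate at which n + 1 integers leave the one-block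
partition is at most ∑_{j ≤ n} 1/(1 - u + j), of order log n, and it dominates ∫ (1 - s₁ⁿ) dν_u. For
n close to e^L the integrand is at least 1/2 on {s₂ > e^{-L}}, and Markov's inequality concludes.

Lower bound (`le_measure_lt_second`): the rate of splitting n + 2 integers into {1, …, n} and a pair
is at least of order n⁻². Weighted by n - 1 and summed for n up to about e^{L/2}, these rates give a
multiple of L. The same weighted sum of paint-box probabilities is at most 5 for every s, and at
most 2(1 - s₁) when s₂ ≤ e^{-L}; since ∫ (1 - s₁) dν_u ≤ 3, the set {s₂ > e^{-L}} must carry mass of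
order L. -/

theorem beta_add_one_left {a b : ℝ} (ha : 0 < a) (hb : 0 < b) :
    beta (a + 1) b = a / (a + b) * beta a b := by
  have h : Real.Gamma (a + b) ≠ 0 := (Real.Gamma_pos_of_pos (by positivity)).ne'
  have h' : a + b ≠ 0 := by positivity
  rw [beta, beta, Real.Gamma_add_one ha.ne', show a + 1 + b = a + b + 1 by ring,
    Real.Gamma_add_one h']
  field_simp

theorem beta_comm (a b : ℝ) : beta a b = beta b a := by
  rw [beta, beta, mul_comm, add_comm]

theorem beta_add_one_right {a b : ℝ} (ha : 0 < a) (hb : 0 < b) :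
    beta a (b + 1) = b / (a + b) * beta a b := by
  rw [beta_comm, beta_add_one_left hb ha, beta_comm, add_comm]

theorem beta_add_nat_left {a b : ℝ} (ha : 0 < a) (hb : 0 < b) (n : ℕ) :
    beta (a + n) b = (∏ j ∈ Finset.range n, (a + j) / (a + b + j)) * beta a b := by
  induction n with
  | zero => simp
  | succ n ih =>
    rw [Finset.prod_range_succ, Nat.cast_succ, ← add_assoc, beta_add_one_left (by positivity) hb,
      ih, show a + n + b = a + b + n by ring]
    ring

/-- Multiplying a beta density by xᵐ(1 - x)ᵏ gives a multiple of another beta density, whose total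
mass is one. -/
theorem lintegral_betaMeasure_pow_mul_pow {a b : ℝ} (ha : 0 < a) (hb : 0 < b) (m k : ℕ) :
    ∫⁻ x, ENNReal.ofReal (x ^ m * (1 - x) ^ k) ∂betaMeasure a b
      = ENNReal.ofReal (beta (a + m) (b + k) / beta a b) := by
  have hpos := beta_pos ha hb
  have hpos' : 0 < beta (a + m) (b + k) := beta_pos (by positivity) (by positivity)
  have hm (a b : ℝ) : Measurable (betaPDF a b) := by unfold betaPDF; fun_prop
  rw [betaMeasure, lintegral_withDensity_eq_lintegral_mul _ (hm a b) (by fun_prop)]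
  have key : ∀ x, (betaPDF a b * fun x => ENNReal.ofReal (x ^ m * (1 - x) ^ k)) x
      = ENNReal.ofReal (beta (a + m) (b + k) / beta a b) * betaPDF (a + m) (b + k) x := by
    intro x
    rw [Pi.mul_apply, betaPDF_eq, betaPDF_eq]
    split_ifs with hx
    · have hx' : 0 < 1 - x := by linarith [hx.2]
      rw [← ENNReal.ofReal_mul' (by have := hx.1; positivity),
        ← ENNReal.ofReal_mul (by positivity)]
      congr 1
      rw [show a + m - 1 = (a - 1) + m by ring, show b + k - 1 = (b - 1) + k by ring,
        Real.rpow_add_natCast hx.1.ne', Real.rpow_add_natCast hx'.ne']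
      field_simp
    · simp
  rw [lintegral_congr key, lintegral_const_mul _ (hm _ _),
    lintegral_betaPDF_eq_one (by positivity) (by positivity), mul_one]

theorem ae_mem_Ioo_betaMeasure (a b : ℝ) : ∀ᵐ x ∂betaMeasure a b, x ∈ Ioo (0 : ℝ) 1 := by
  have hm : Measurable (betaPDF a b) := by unfold betaPDF; fun_prop
  rw [betaMeasure, ae_withDensity_iff hm]
  refine ae_of_all _ fun x hx => ?_
  by_contra h
  exact hx ((betaPDF_eq a b x).trans (by rw [if_neg (show ¬(0 < x ∧ x < 1) from h), ENNReal.ofReal_zero]))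

/-! ### Ranked sequences and stick-breaking -/

theorem sum_stickBreaking (Y : ℕ → ℝ) (n : ℕ) :
    ∑ i ∈ Finset.range n, stickBreaking Y i = 1 - ∏ i ∈ Finset.range n, (1 - Y i) := by
  induction n with
  | zero => simp
  | succ n ih => rw [Finset.sum_range_succ, ih, Finset.prod_range_succ, stickBreaking]; ring

theorem stickBreaking_nonneg {Y : ℕ → ℝ} (hY : ∀ n, Y n ∈ Ioo (0 : ℝ) 1) (n : ℕ) :
    0 ≤ stickBreaking Y n :=
  mul_nonneg (Finset.prod_nonneg fun i _ => by linarith [(hY i).2]) (hY n).1.le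

theorem sum_stickBreaking_le_one {Y : ℕ → ℝ} (hY : ∀ n, Y n ∈ Ioo (0 : ℝ) 1) (S : Finset ℕ) :
    ∑ i ∈ S, stickBreaking Y i ≤ 1 := by
  calc ∑ i ∈ S, stickBreaking Y i
      ≤ ∑ i ∈ Finset.range (S.sup id + 1), stickBreaking Y i :=
        Finset.sum_le_sum_of_subset_of_nonneg
          (fun i hi => Finset.mem_range.2 (Nat.lt_succ_of_le (Finset.le_sup (f := id) hi)))
          fun i _ _ => stickBreaking_nonneg hY i
    _ ≤ 1 := by
        rw [sum_stickBreaking]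
        linarith [Finset.prod_nonneg fun i (_ : i ∈ Finset.range (S.sup id + 1)) =>
          show 0 ≤ 1 - Y i by linarith [(hY i).2]]

section ranked

variable {f : ℕ → ℝ}

theorem bddAbove_ranked (hf : ∀ i, f i ≤ 1) (n : ℕ) :
    BddAbove (range fun F : {F : Finset ℕ // F.card = n + 1} =>
      F.1.inf' (Finset.card_pos.1 (F.2.symm ▸ Nat.succ_pos n)) f) := by
  refine ⟨1, ?_⟩
  rintro _ ⟨F, rfl⟩
  obtain ⟨i, hi⟩ := Finset.card_pos.1 (F.2.symm ▸ Nat.succ_pos n : 0 < F.1.card)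
  exact (Finset.inf'_le f hi).trans (hf i)

theorem le_ranked (hf : ∀ i, f i ≤ 1) {n : ℕ} {F : Finset ℕ} (hF : F.card = n + 1) {c : ℝ}
    (hc : ∀ i ∈ F, c ≤ f i) : c ≤ ranked f n :=
  (Finset.le_inf' _ _ hc).trans (le_ciSup (bddAbove_ranked hf n) ⟨F, hF⟩)

theorem exists_lt_of_lt_ranked {n : ℕ} {c : ℝ} (hc : c < ranked f n) :
    ∃ F : Finset ℕ, F.card = n + 1 ∧ ∀ i ∈ F, c < f i := by
  have : Nonempty {F : Finset ℕ // F.card = n + 1} := ⟨⟨Finset.range (n + 1), by simp⟩⟩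
  obtain ⟨F, hF⟩ := exists_lt_of_lt_ciSup hc
  exact ⟨F.1, F.2, (Finset.lt_inf'_iff _).1 hF⟩

/-- Greedy choice: a set of n + 1 indices with nearly optimal minimum always contains one outside
the n indices already chosen. The slack δ is there because the suprema need not be attained. This
transfers the bound on finite sums of f to the partial sums of its rearrangement. -/
theorem exists_sum_ranked_le (n : ℕ) {δ : ℝ} (hδ : 0 < δ) :
    ∃ S : Finset ℕ, S.card = n ∧
      ∑ i ∈ Finset.range n, (ranked f i - δ) ≤ ∑ i ∈ S, f i := by
  induction n with
  | zero => exact ⟨∅, by simp⟩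
  | succ n ih =>
    obtain ⟨S, hS, hle⟩ := ih
    obtain ⟨F, hF, hlt⟩ := exists_lt_of_lt_ranked (sub_lt_self (ranked f n) hδ)
    obtain ⟨x, hxF, hxS⟩ := Finset.exists_mem_notMem_of_card_lt_card (s := S) (t := F) (by omega)
    refine ⟨insert x S, by rw [Finset.card_insert_of_notMem hxS, hS], ?_⟩
    rw [Finset.sum_range_succ, Finset.sum_insert hxS]
    linarith [hlt x hxF]

theorem isMassPartition_ranked (h0 : ∀ i, 0 ≤ f i) (h1 : ∀ S : Finset ℕ, ∑ i ∈ S, f i ≤ 1) :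
    IsMassPartition (ranked f) := by
  have hf : ∀ i, f i ≤ 1 := fun i => by simpa using h1 {i}
  refine ⟨antitone_nat_of_succ_le fun n => ?_, fun n => ?_, fun n => ?_⟩
  · refine le_of_forall_lt fun c hc => ?_
    obtain ⟨c', hcc', hc'⟩ := exists_between hc
    obtain ⟨F, hF, hlt⟩ := exists_lt_of_lt_ranked hc'
    obtain ⟨x, hx⟩ := Finset.card_pos.1 (hF.symm ▸ Nat.succ_pos _ : 0 < F.card)
    refine hcc'.trans_le (le_ranked hf (F := F.erase x) ?_ fun i hi =>
      (hlt i (Finset.mem_of_mem_erase hi)).le)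
    rw [Finset.card_erase_of_mem hx, hF]
    rfl
  · exact le_ranked hf (F := Finset.range (n + 1)) (by simp) fun i _ => h0 i
  · refine le_of_forall_pos_le_add fun ε hε => ?_
    obtain ⟨S, -, hS⟩ := exists_sum_ranked_le (f := f) n (δ := ε / (n + 1)) (by positivity)
    rw [Finset.sum_sub_distrib, Finset.sum_const, Finset.card_range, nsmul_eq_mul] at hS
    have : n * (ε / (n + 1)) ≤ ε := by
      rw [← mul_div_assoc, div_le_iff₀ (by positivity)]
      nlinarith
    linarith [h1 S]

end ranked

/-- The ranked stick-breaking sequence is almost surely a mass-partition whose two largest terms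
dominate the first two sticks. -/
theorem ofSeq_ranked_stickBreaking {Y : ℕ → ℝ} (hY : ∀ n, Y n ∈ Ioo (0 : ℝ) 1) :
    let s := MassPartition.ofSeq (ranked (stickBreaking Y))
    Y 0 ≤ s.1 0 ∧ (1 - Y 0) * Y 1 ≤ s.1 0 ∧ min (Y 0) ((1 - Y 0) * Y 1) ≤ s.1 1 := by
  have h0 := stickBreaking_nonneg hY
  have h1 := sum_stickBreaking_le_one hY
  have hf : ∀ i, stickBreaking Y i ≤ 1 := fun i => by simpa using h1 {i}
  have e0 : stickBreaking Y 0 = Y 0 := by simp [stickBreaking]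
  have e1 : stickBreaking Y 1 = (1 - Y 0) * Y 1 := by simp [stickBreaking]
  have hs : (MassPartition.ofSeq (ranked (stickBreaking Y))).1 = ranked (stickBreaking Y) :=
    congrArg Subtype.val (dif_pos (isMassPartition_ranked h0 h1) :
      MassPartition.ofSeq (ranked (stickBreaking Y)) = ⟨_, isMassPartition_ranked h0 h1⟩)
  intro s
  simp only [s, hs]
  refine ⟨?_, ?_, ?_⟩
  · exact le_ranked hf (F := {0}) rfl (by simp [e0])
  · exact le_ranked hf (F := {1}) rfl (by simp [e1])
  · exact le_ranked hf (F := {0, 1}) rfl (by simp [e0, e1])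

/-! ### Paint-boxes -/

namespace MassPartition

variable (s : MassPartition)

theorem le_one (k : ℕ) : s.1 k ≤ 1 := by
  have h := s.2.2.2 (k + 1)
  rw [Finset.sum_range_succ] at h
  linarith [Finset.sum_nonneg fun i (_ : i ∈ Finset.range k) => s.2.2.1 i]

theorem second_le : s.1 1 ≤ 1 - s.1 0 := by
  have h := s.2.2.2 2
  simp only [Finset.sum_range_succ, Finset.sum_range_zero] at h
  linarith

theorem measurable_apply (k : ℕ) : Measurable fun s : MassPartition => s.1 k :=
  (measurable_pi_apply k).comp measurable_subtype_coe

theorem monotone_sum : Monotone fun k => ∑ i ∈ Finset.range k, s.1 i :=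
  monotone_nat_of_le_succ fun n => by
    rw [Finset.sum_range_succ]
    linarith [s.2.2.1 n]

theorem interval_unique {x : ℝ} {k l : ℕ} (hk : x ∈ s.interval k) (hl : x ∈ s.interval l) :
    k = l := by
  by_contra h
  rcases lt_or_gt_of_ne h with h | h
  · linarith [hk.2, hl.1, s.monotone_sum (Nat.succ_le_of_lt h)]
  · linarith [hl.2, hk.1, s.monotone_sum (Nat.succ_le_of_lt h)]

theorem volume_interval (k : ℕ) :
    (volume : Measure ℝ).restrict (Icc 0 1) (s.interval k) = ENNReal.ofReal (s.1 k) := by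
  have hsub : s.interval k ⊆ Icc 0 1 := fun x hx =>
    ⟨(Finset.sum_nonneg fun i _ => s.2.2.1 i).trans hx.1, hx.2.le.trans (s.2.2.2 _)⟩
  rw [Measure.restrict_eq_self _ hsub, interval, Real.volume_Ico, Finset.sum_range_succ,
    add_sub_cancel_left]

theorem tsum_ofReal_le_one : ∑' k, ENNReal.ofReal (s.1 k) ≤ 1 := by
  refine ENNReal.tsum_le_of_sum_range_le fun n => ?_
  rw [← ENNReal.ofReal_sum_of_nonneg fun i _ => s.2.2.1 i]
  exact ENNReal.ofReal_le_one.2 (s.2.2.2 n)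

theorem tsum_ofReal_succ_le : ∑' k, ENNReal.ofReal (s.1 (k + 1)) ≤ ENNReal.ofReal (1 - s.1 0) := by
  refine ENNReal.tsum_le_of_sum_range_le fun n => ?_
  rw [← ENNReal.ofReal_sum_of_nonneg fun i _ => s.2.2.1 _]
  refine ENNReal.ofReal_le_ofReal ?_
  have h := s.2.2.2 (n + 1)
  rw [Finset.sum_range_succ'] at h
  linarith

/-- The partition of `{1, …, n}` induced by the paint-box of `s` at the sample `U`. -/
def sampled {n : ℕ} (U : Fin n → ℝ) : Setoid (Fin n) where
  r i j := i = j ∨ ∃ k, U i ∈ s.interval k ∧ U j ∈ s.interval k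
  iseqv :=
    { refl := fun _ => Or.inl rfl
      symm := by
        rintro i j (h | ⟨k, h⟩)
        · exact Or.inl h.symm
        · exact Or.inr ⟨k, h.symm⟩
      trans := by
        rintro i j l (rfl | ⟨k, h⟩) (rfl | ⟨k', h'⟩)
        · exact Or.inl rfl
        · exact Or.inr ⟨k', h'⟩
        · exact Or.inr ⟨k, h⟩
        · obtain rfl := s.interval_unique h.2 h'.1
          exact Or.inr ⟨k, h.1, h'.2⟩ }

/-- As fibres of one map into a finite type, the paint-box events are disjoint and exhaustive, so
their probabilities sum to one. -/
theorem setOf_eq_sampled_preimage {n : ℕ} (π : Setoid (Fin n)) :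
    {U : Fin n → ℝ | ∀ i j, π i j ↔ i = j ∨ ∃ k, U i ∈ s.interval k ∧ U j ∈ s.interval k}
      = s.sampled ⁻¹' {π} := by
  ext U
  refine ⟨fun h => Setoid.ext fun i j => (h i j).symm, ?_⟩
  rintro rfl i j
  exact Iff.rfl

end MassPartition

theorem measurableSet_paintBox {n : ℕ} (π : Setoid (Fin n)) :
    MeasurableSet {p : MassPartition × (Fin n → ℝ) | ∀ i j, π i j ↔
      i = j ∨ ∃ k, p.2 i ∈ p.1.interval k ∧ p.2 j ∈ p.1.interval k} := by
  have hsum (k : ℕ) : Measurable fun p : MassPartition × (Fin n → ℝ) =>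
      ∑ i ∈ Finset.range k, p.1.1 i :=
    Finset.measurable_sum _ fun i _ => (MassPartition.measurable_apply i).comp measurable_fst
  have hU (i : Fin n) : Measurable fun p : MassPartition × (Fin n → ℝ) => p.2 i :=
    (measurable_pi_apply i).comp measurable_snd
  have hk (i : Fin n) (k : ℕ) :
      MeasurableSet {p : MassPartition × (Fin n → ℝ) | p.2 i ∈ p.1.interval k} :=
    (measurableSet_le (hsum k) (hU i)).inter (measurableSet_lt (hU i) (hsum (k + 1)))
  have hQ (i j : Fin n) : MeasurableSet {p : MassPartition × (Fin n → ℝ) |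
      i = j ∨ ∃ k, p.2 i ∈ p.1.interval k ∧ p.2 j ∈ p.1.interval k} := by
    refine (MeasurableSet.const (i = j)).union
      (s₂ := {p : MassPartition × (Fin n → ℝ) | ∃ k, p.2 i ∈ p.1.interval k ∧ p.2 j ∈ p.1.interval k}) ?_
    rw [ofPred_exists]
    exact MeasurableSet.iUnion fun k => (hk i k).inter (hk j k)
  simp only [ofPred_forall]
  refine MeasurableSet.iInter fun i => MeasurableSet.iInter fun j => ?_
  by_cases h : π i j
  · simpa only [h, true_iff] using hQ i j
  · simp only [h, false_iff]
    exact (hQ i j).compl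

theorem measurable_paintBox {n : ℕ} (π : Setoid (Fin n)) :
    Measurable fun s : MassPartition => paintBox s π :=
  measurable_measure_prodMk_left (measurableSet_paintBox π)

instance : IsProbabilityMeasure ((volume : Measure ℝ).restrict (Icc 0 1)) :=
  ⟨by simp⟩

instance (n : ℕ) : Finite (Setoid (Fin n)) :=
  Finite.of_injective (fun π : Setoid (Fin n) => fun i j => π i j) fun _ _ h =>
    Setoid.ext fun i j => by simpa using congrFun (congrFun h i) j

noncomputable instance (n : ℕ) : Fintype (Setoid (Fin n)) := Fintype.ofFinite _

noncomputable instance (n : ℕ) : DecidableEq (Setoid (Fin n)) := Classical.decEq _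

theorem sum_paintBox (s : MassPartition) (n : ℕ) :
    ∑ π : Setoid (Fin n), paintBox s π = 1 := by
  have h (π : Setoid (Fin n)) : MeasurableSet (s.sampled ⁻¹' {π}) := by
    rw [← MassPartition.setOf_eq_sampled_preimage]
    exact measurable_prodMk_left (x := s) (measurableSet_paintBox π)
  simp only [paintBox, MassPartition.setOf_eq_sampled_preimage]
  rw [sum_measure_preimage_singleton _ fun π _ => h π]
  simp

theorem le_paintBox_top (s : MassPartition) (n : ℕ) :
    ENNReal.ofReal (s.1 0) ^ n ≤ paintBox s (⊤ : Setoid (Fin n)) := by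
  have hsub : univ.pi (fun _ : Fin n => s.interval 0) ⊆ {U | ∀ i j, (⊤ : Setoid (Fin n)) i j ↔
      i = j ∨ ∃ k, U i ∈ s.interval k ∧ U j ∈ s.interval k} := fun U hU i j =>
    ⟨fun _ => Or.inr ⟨0, hU i trivial, hU j trivial⟩, fun _ => trivial⟩
  refine le_trans (le_of_eq ?_) (measure_mono hsub)
  simp [Measure.pi_pi, s.volume_interval]

/-- All n + 1 points fall in a common interval, so the probability is at most ∑ s_kⁿ⁺¹ ≤ s₁ⁿ ∑ s_k.
-/
theorem paintBox_top_le (s : MassPartition) {n : ℕ} (hn : 1 ≤ n) :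
    paintBox s (⊤ : Setoid (Fin (n + 1))) ≤ ENNReal.ofReal (s.1 0) ^ n := by
  have hsub : {U | ∀ i j, (⊤ : Setoid (Fin (n + 1))) i j ↔
      i = j ∨ ∃ k, U i ∈ s.interval k ∧ U j ∈ s.interval k} ⊆
      ⋃ k, univ.pi (fun _ : Fin (n + 1) => s.interval k) := by
    intro U hU
    have h0 (j : Fin (n + 1)) := (hU 0 j).1 trivial
    -- A second point is needed: a lone point may lie in no interval at all.
    have hne : (0 : Fin (n + 1)) ≠ Fin.last n := by
      rw [Ne, Fin.ext_iff, Fin.val_zero, Fin.val_last]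
      omega
    obtain ⟨k, hk, -⟩ := (h0 (Fin.last n)).resolve_left hne
    refine mem_iUnion.2 ⟨k, fun j _ => ?_⟩
    rcases h0 j with rfl | ⟨k', h1, h2⟩
    · exact hk
    · rwa [s.interval_unique hk h1]
  calc paintBox s (⊤ : Setoid (Fin (n + 1)))
      ≤ ∑' k, ENNReal.ofReal (s.1 k) ^ (n + 1) := by
        refine (measure_mono hsub).trans ((measure_iUnion_le _).trans (le_of_eq ?_))
        simp [Measure.pi_pi, s.volume_interval]
    _ ≤ ∑' k, ENNReal.ofReal (s.1 0) ^ n * ENNReal.ofReal (s.1 k) := by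
        refine ENNReal.tsum_le_tsum fun k => ?_
        rw [pow_succ]
        gcongr
        exact s.2.1 (Nat.zero_le k)
    _ ≤ ENNReal.ofReal (s.1 0) ^ n := by
        rw [ENNReal.tsum_mul_left]
        exact mul_le_of_le_one_right' s.tsum_ofReal_le_one

/-! ### Partitions into a block and a pair -/

/-- The partition of `{1, …, n + 2}` into `{1, …, n}` and `{n + 1, n + 2}`. -/
def splitPair (n : ℕ) : Setoid (Fin (n + 2)) := Setoid.comap (fun i => i.1 < n) ⊥

theorem splitPair_iff {n : ℕ} {i j : Fin (n + 2)} : splitPair n i j ↔ (i.1 < n ↔ j.1 < n) :=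
  eq_iff_iff

theorem splitPair_ne_top {n : ℕ} (hn : 1 ≤ n) : splitPair n ≠ ⊤ := by
  intro h
  have : splitPair n 0 (Fin.last _) := by rw [h]; trivial
  rw [splitPair_iff, Fin.val_zero, Fin.val_last] at this
  omega

/-- Both blocks have at least two elements, so erosion, which only detaches singletons, does not
contribute to this rate. -/
theorem erosionMass_splitPair {n : ℕ} (hn : 2 ≤ n) : erosionMass (splitPair n) = 0 := by
  rw [erosionMass, Set.ncard_eq_zero, Set.eq_empty_iff_forall_notMem]
  intro i hi
  have h0 := hi 0 ⟨1, by omega⟩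
  have h1 := hi ⟨n, by omega⟩ ⟨n + 1, by omega⟩
  have h2 := hi 0 ⟨n, by omega⟩
  simp only [splitPair_iff, Fin.ext_iff, Fin.val_zero] at h0 h1 h2
  omega

theorem pi_splitPair (s : MassPartition) (n k l : ℕ) :
    Measure.pi (fun _ : Fin (n + 2) => (volume : Measure ℝ).restrict (Icc 0 1))
      (univ.pi fun i => if i.1 < n then s.interval k else s.interval l)
      = ENNReal.ofReal (s.1 k) ^ n * ENNReal.ofReal (s.1 l) ^ 2 := by
  rw [Measure.pi_pi, Fin.prod_univ_castSucc, Fin.prod_univ_castSucc]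
  simp [s.volume_interval, pow_two, mul_assoc]

theorem le_paintBox_splitPair (s : MassPartition) (n : ℕ) {k l : ℕ} (hkl : k ≠ l) :
    ENNReal.ofReal (s.1 k) ^ n * ENNReal.ofReal (s.1 l) ^ 2 ≤ paintBox s (splitPair n) := by
  rw [← pi_splitPair]
  refine measure_mono fun U hU i j => ?_
  have hi := hU i trivial
  have hj := hU j trivial
  rw [splitPair_iff]
  dsimp only at hi hj
  split_ifs at hi hj with h1 h2 h2
  · exact ⟨fun _ => Or.inr ⟨k, hi, hj⟩, fun _ => by tauto⟩
  · refine ⟨fun h => by tauto, ?_⟩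
    rintro (rfl | ⟨m, h, h'⟩)
    · tauto
    · exact absurd ((s.interval_unique hi h).trans (s.interval_unique h' hj)) hkl
  · refine ⟨fun h => by tauto, ?_⟩
    rintro (rfl | ⟨m, h, h'⟩)
    · tauto
    · exact absurd ((s.interval_unique hj h').trans (s.interval_unique h hi)) hkl
  · exact ⟨fun _ => Or.inr ⟨l, hi, hj⟩, fun _ => by tauto⟩

/-- With at least two points in each block, neither block can be dust: each occupies an interval,
and the two intervals differ. -/
theorem paintBox_splitPair_le_tsum (s : MassPartition) {n : ℕ} (hn : 2 ≤ n) :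
    paintBox s (splitPair n) ≤ ∑' k, ∑' l, if k = l then 0 else
      ENNReal.ofReal (s.1 k) ^ n * ENNReal.ofReal (s.1 l) ^ 2 := by
  have hsub : {U | ∀ i j, splitPair n i j ↔
      i = j ∨ ∃ k, U i ∈ s.interval k ∧ U j ∈ s.interval k} ⊆
      ⋃ k, ⋃ l, if k = l then ∅ else
        univ.pi fun i : Fin (n + 2) => if i.1 < n then s.interval k else s.interval l := by
    intro U hU
    set z : Fin (n + 2) := ⟨n, by omega⟩
    have h0 (j : Fin (n + 2)) (hj : j.1 < n) := (hU 0 j).1 (splitPair_iff.2 (by simp; omega))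
    have h1 (j : Fin (n + 2)) (hj : ¬ j.1 < n) := (hU z j).1 (splitPair_iff.2 (by simp [z, hj]))
    obtain ⟨k, hk, -⟩ := (h0 ⟨1, by omega⟩ (by simp; omega)).resolve_left (by simp)
    obtain ⟨l, hl, -⟩ := (h1 ⟨n + 1, by omega⟩ (by simp)).resolve_left (by simp [z])
    have hkl : k ≠ l := by
      rintro rfl
      have := splitPair_iff.1 ((hU 0 z).2 (Or.inr ⟨k, hk, hl⟩))
      simp only [Fin.val_zero, z] at this
      omega
    refine mem_iUnion.2 ⟨k, mem_iUnion.2 ⟨l, ?_⟩⟩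
    rw [if_neg hkl]
    intro j _
    dsimp only
    split_ifs with hj
    · rcases h0 j hj with rfl | ⟨k', h, h'⟩
      · exact hk
      · rwa [s.interval_unique hk h]
    · rcases h1 j hj with rfl | ⟨k', h, h'⟩
      · exact hl
      · rwa [s.interval_unique hl h]
  refine (measure_mono hsub).trans ((measure_iUnion_le _).trans
    (ENNReal.tsum_le_tsum fun k => (measure_iUnion_le _).trans
    (ENNReal.tsum_le_tsum fun l => le_of_eq ?_)))
  split_ifs
  · simp
  · exact pi_splitPair s n k l

/-- If the large block occupies the largest interval, the pair contributes ∑_{l ≥ 2} s_l² ≤ s₂(1 -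
s₁). Otherwise its interval has length at most 1/2, and two of its m + 2 factors supply the same sum
of squares. -/
theorem paintBox_splitPair_le (s : MassPartition) (m : ℕ) :
    paintBox s (splitPair (m + 2))
      ≤ ENNReal.ofReal (s.1 1 * (1 - s.1 0) * (s.1 0 ^ m + (1 / 2) ^ m)) := by
  have hs0 := s.2.2.1 0
  have hs1 := s.2.2.1 1
  have hs01 := s.le_one 0
  have hsq : ∑' k, ENNReal.ofReal (s.1 (k + 1)) ^ 2 ≤ ENNReal.ofReal (s.1 1 * (1 - s.1 0)) := by
    rw [ENNReal.ofReal_mul hs1]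
    refine le_trans ?_ (mul_le_mul_right s.tsum_ofReal_succ_le _)
    rw [← ENNReal.tsum_mul_left]
    refine ENNReal.tsum_le_tsum fun k => ?_
    rw [pow_two]
    gcongr
    exact s.2.1 (by omega)
  have hsq' : ∑' k, ENNReal.ofReal (s.1 k) ^ 2 ≤ 1 := by
    refine le_trans (ENNReal.tsum_le_tsum fun k => ?_) s.tsum_ofReal_le_one
    rw [pow_two]
    exact mul_le_of_le_one_right' (ENNReal.ofReal_le_one.2 (s.le_one k))
  have hhalf (k : ℕ) : s.1 (k + 1) ≤ 1 / 2 := by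
    linarith [s.2.1 (show 1 ≤ k + 1 by omega), s.2.1 (show 0 ≤ 1 by omega), s.second_le]
  refine (paintBox_splitPair_le_tsum s (by omega)).trans ?_
  rw [tsum_eq_zero_add' ENNReal.summable, mul_add, ENNReal.ofReal_add
    (mul_nonneg (mul_nonneg hs1 (by linarith)) (by positivity))
    (mul_nonneg (mul_nonneg hs1 (by linarith)) (by positivity))]
  refine add_le_add ?_ ?_
  · rw [tsum_eq_zero_add' ENNReal.summable]
    simp only [if_true, zero_add, Nat.right_eq_add, Nat.add_eq_zero_iff, one_ne_zero, and_false,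
      if_false, ENNReal.tsum_mul_left]
    rw [mul_comm, ENNReal.ofReal_mul' (by positivity), ENNReal.ofReal_pow hs0]
    exact mul_le_mul' hsq (pow_le_pow_right_of_le_one' (ENNReal.ofReal_le_one.2 hs01) (by omega))
  · rw [ENNReal.ofReal_mul' (by positivity)]
    refine le_trans ?_ (mul_le_mul_left hsq _)
    rw [← ENNReal.tsum_mul_right]
    refine ENNReal.tsum_le_tsum fun k => ?_
    calc _ ≤ ∑' l, ENNReal.ofReal (s.1 (k + 1)) ^ (m + 2) * ENNReal.ofReal (s.1 l) ^ 2 :=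
          ENNReal.tsum_le_tsum fun l => by split_ifs <;> simp
      _ ≤ ENNReal.ofReal (s.1 (k + 1)) ^ (m + 2) := by
          rw [ENNReal.tsum_mul_left]
          exact mul_le_of_le_one_right' hsq'
      _ ≤ _ := by
          rw [add_comm m 2, pow_add, ENNReal.ofReal_pow (by norm_num)]
          gcongr
          exact hhalf k

/-- Partial sums of ∑ (m + 1) rᵐ = (1 - r)⁻², with explicit remainder; the product form also covers
r = 1. -/
theorem sum_add_one_mul_pow_mul_le (N : ℕ) {r : ℝ} (h0 : 0 ≤ r) (h1 : r ≤ 1) :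
    (∑ m ∈ Finset.range N, (m + 1 : ℝ) * r ^ m) * (1 - r) ^ 2 ≤ 1 := by
  have key : (∑ m ∈ Finset.range N, (m + 1 : ℝ) * r ^ m) * (1 - r) ^ 2
      = 1 - r ^ N * (N * (1 - r) + 1) := by
    induction N with
    | zero => simp
    | succ N ih =>
      rw [Finset.sum_range_succ, add_mul, ih]
      push_cast
      ring
  rw [key]
  have : 0 ≤ 1 - r := by linarith
  have : 0 ≤ r ^ N * (N * (1 - r) + 1) := by positivity
  linarith

theorem sum_paintBox_splitPair_le (s : MassPartition) (N : ℕ) :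
    ∑ m ∈ Finset.range N, ENNReal.ofReal (m + 1) * paintBox s (splitPair (m + 2))
      ≤ ENNReal.ofReal (s.1 1 * (1 - s.1 0) *
        ∑ m ∈ Finset.range N, (m + 1 : ℝ) * (s.1 0 ^ m + (1 / 2) ^ m)) := by
  have hs0 := s.2.2.1 0
  have hs1 := s.2.2.1 1
  have hs01 : 0 ≤ 1 - s.1 0 := by linarith [s.le_one 0]
  rw [Finset.mul_sum, ENNReal.ofReal_sum_of_nonneg fun m _ => by positivity]
  refine Finset.sum_le_sum fun m _ => ?_
  refine (mul_le_mul_right (paintBox_splitPair_le s m) _).trans (le_of_eq ?_)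
  rw [← ENNReal.ofReal_mul (by positivity)]
  congr 1
  ring

/-- The weights m + 1 produce a factor (1 - s₁)⁻², which exactly compensates s₂(1 - s₁) ≤ (1 - s₁)².
The bound is therefore uniform in both N and s: 1 from the powers of s₁, 4 from those of 1/2. -/
theorem sum_paintBox_splitPair_le_five (s : MassPartition) (N : ℕ) :
    ∑ m ∈ Finset.range N, ENNReal.ofReal (m + 1) * paintBox s (splitPair (m + 2)) ≤ 5 := by
  refine (sum_paintBox_splitPair_le s N).trans ?_
  rw [show (5 : ℝ≥0∞) = ENNReal.ofReal 5 by simp]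
  refine ENNReal.ofReal_le_ofReal ?_
  have hs0 := s.2.2.1 0
  have hs1 := s.2.2.1 1
  have hs01 := s.le_one 0
  have h1 := sum_add_one_mul_pow_mul_le N hs0 hs01
  have h2 := sum_add_one_mul_pow_mul_le N (r := 1 / 2) (by norm_num) (by norm_num)
  simp only [mul_add (_ + _ : ℝ), Finset.sum_add_distrib]
  set A := ∑ m ∈ Finset.range N, (m + 1 : ℝ) * s.1 0 ^ m
  set B := ∑ m ∈ Finset.range N, (m + 1 : ℝ) * (1 / 2) ^ m
  have hA0 : 0 ≤ A := Finset.sum_nonneg fun m _ => by positivity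
  have hB0 : 0 ≤ B := Finset.sum_nonneg fun m _ => by positivity
  set x := 1 - s.1 0
  have hx0 : 0 ≤ x := by linarith
  calc s.1 1 * x * (A + B) ≤ x * x * (A + B) := by
        gcongr
        exact s.second_le
    _ = A * x ^ 2 + x * x * B := by ring
    _ ≤ 1 + 1 * 1 * 4 := by
        gcongr <;> linarith
    _ = 5 := by norm_num

/-- A crude count of N terms, each at most 2N, keeps the factor s₂; it serves when s₂ is small
compared with N⁻². -/
theorem sum_paintBox_splitPair_le_sq (s : MassPartition) (N : ℕ) :
    ∑ m ∈ Finset.range N, ENNReal.ofReal (m + 1) * paintBox s (splitPair (m + 2))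
      ≤ ENNReal.ofReal (2 * N ^ 2 * s.1 1) * ENNReal.ofReal (1 - s.1 0) := by
  refine (sum_paintBox_splitPair_le s N).trans ?_
  have hs0 := s.2.2.1 0
  have hs1 := s.2.2.1 1
  have hs01 := s.le_one 0
  rw [← ENNReal.ofReal_mul (by positivity)]
  refine ENNReal.ofReal_le_ofReal ?_
  have : ∑ m ∈ Finset.range N, (m + 1 : ℝ) * (s.1 0 ^ m + (1 / 2) ^ m) ≤ 2 * N ^ 2 := by
    calc _ ≤ ∑ m ∈ Finset.range N, (N : ℝ) * (1 + 1) := by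
          refine Finset.sum_le_sum fun m hm => ?_
          have : (m + 1 : ℝ) ≤ N := by exact_mod_cast Finset.mem_range.1 hm
          gcongr
          · exact pow_le_one₀ hs0 hs01
          · exact pow_le_one₀ (by norm_num) (by norm_num)
      _ = 2 * N ^ 2 := by
          rw [Finset.sum_const, Finset.card_range, nsmul_eq_mul]
          ring
  calc _ ≤ s.1 1 * (1 - s.1 0) * (2 * N ^ 2) :=
        mul_le_mul_of_nonneg_left this (mul_nonneg hs1 (by linarith))
    _ = _ := by ring

/-! ### Poisson-Dirichlet laws at small times -/

section poissonDirichlet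

variable {t h : ℝ}

theorem betaParameter_pos (ht : 0 ≤ t) (hh : 0 < h) (n : ℕ) :
    0 < -t + ((n : ℝ) + 1) * (t + h) := by
  have : 0 ≤ (n : ℝ) * (t + h) := by positivity
  linarith

theorem isProbabilityMeasure_beta_stick (ht : 0 ≤ t) (hh : 0 < h) (hth : t + h < 1) (n : ℕ) :
    IsProbabilityMeasure (betaMeasure (1 - (t + h)) (-t + ((n : ℝ) + 1) * (t + h))) :=
  isProbabilityMeasureBeta (by linarith) (betaParameter_pos ht hh n)

theorem isProbabilityMeasure_poissonDirichlet (ht : 0 ≤ t) (hh : 0 < h) (hth : t + h < 1) :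
    IsProbabilityMeasure (poissonDirichlet (t + h) (-t)) := by
  have := isProbabilityMeasure_beta_stick ht hh hth
  exact Measure.isProbabilityMeasure_map measurable_ofSeq_ranked_stickBreaking.aemeasurable

theorem ae_mem_Ioo_infinitePi_beta (ht : 0 ≤ t) (hh : 0 < h) (hth : t + h < 1) :
    ∀ᵐ Y ∂Measure.infinitePi fun n : ℕ =>
      betaMeasure (1 - (t + h)) (-t + ((n : ℝ) + 1) * (t + h)), ∀ n, Y n ∈ Ioo (0 : ℝ) 1 := by
  have := isProbabilityMeasure_beta_stick ht hh hth
  exact ae_all_iff.2 fun n =>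
    (measurePreserving_eval_infinitePi (fun n : ℕ =>
      betaMeasure (1 - (t + h)) (-t + ((n : ℝ) + 1) * (t + h))) n).quasiMeasurePreserving.ae
      (ae_mem_Ioo_betaMeasure _ _)

/-- The paint-box gives one block with probability at least s₁ⁿ ≥ Y₀ⁿ, and Y₀ is beta with
parameters 1 - t - h and h. -/
theorem le_paintBoxMass_top (ht : 0 ≤ t) (hh : 0 < h) (hth : t + h < 1) (n : ℕ) :
    ENNReal.ofReal (∏ j ∈ Finset.range n, (1 - h / (1 - t + j)))
      ≤ paintBoxMass (poissonDirichlet (t + h) (-t)) (⊤ : Setoid (Fin n)) := by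
  have := isProbabilityMeasure_beta_stick ht hh hth
  have ha : 0 < 1 - (t + h) := by linarith
  rw [paintBoxMass, poissonDirichlet,
    lintegral_map (measurable_paintBox _) measurable_ofSeq_ranked_stickBreaking]
  have hb := lintegral_betaMeasure_pow_mul_pow ha hh n 0
  rw [Nat.cast_zero, add_zero, beta_add_nat_left ha hh, mul_div_assoc,
    div_self (beta_pos ha hh).ne', mul_one] at hb
  have e : ∏ j ∈ Finset.range n, (1 - h / (1 - t + j))
      = ∏ j ∈ Finset.range n, (1 - (t + h) + j) / (1 - (t + h) + h + j) := by
    refine Finset.prod_congr rfl fun j _ => ?_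
    have : 0 < 1 - t + j := by have : (0 : ℝ) ≤ j := j.cast_nonneg; linarith
    rw [show 1 - (t + h) + h + j = 1 - t + j by ring]
    field_simp
    ring
  have he := (measurePreserving_eval_infinitePi (fun n : ℕ =>
      betaMeasure (1 - (t + h)) (-t + ((n : ℝ) + 1) * (t + h))) 0).lintegral_comp
      (f := fun x => ENNReal.ofReal (x ^ n * (1 - x) ^ 0)) (by fun_prop)
  rw [show -t + (((0 : ℕ) : ℝ) + 1) * (t + h) = h by push_cast; ring, hb, ← e] at he
  rw [← he]
  refine lintegral_mono_ae ?_
  filter_upwards [ae_mem_Ioo_infinitePi_beta ht hh hth] with Y hY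
  refine le_trans ?_ (le_paintBox_top _ _)
  rw [pow_zero, mul_one, ENNReal.ofReal_pow (hY 0).1.le]
  gcongr
  exact (ofSeq_ranked_stickBreaking hY).1

/-- Put the large block in the first stick and the pair in the second: by independence this costs
E[Y₀ⁿ(1 - Y₀)²] E[Y₁²]. The factor h, which makes this a rate, comes from the second parameter h of
the law of Y₀. -/
theorem le_paintBoxMass_splitPair (ht : 0 ≤ t) (hh : 0 < h) (hth : t + h < 1) (n : ℕ) :
    ENNReal.ofReal h * ENNReal.ofReal ((h + 1) / ((1 - t + n + 1) * (1 - t + n)) *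
        (∏ j ∈ Finset.range n, (1 - h / (1 - t + j))) *
        ((1 - t - h) * (2 - t - h) / ((1 + h) * (2 + h))))
      ≤ paintBoxMass (poissonDirichlet (t + h) (-t)) (splitPair n) := by
  have := isProbabilityMeasure_beta_stick ht hh hth
  have ha : 0 < 1 - (t + h) := by linarith
  have hb : 0 < t + 2 * h := by linarith
  rw [paintBoxMass, poissonDirichlet,
    lintegral_map (measurable_paintBox _) measurable_ofSeq_ranked_stickBreaking]
  set μ := fun n : ℕ => betaMeasure (1 - (t + h)) (-t + ((n : ℝ) + 1) * (t + h)) with hμ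
  have hμ0 : μ 0 = betaMeasure (1 - (t + h)) h := by
    simp only [hμ]; congr 1; push_cast; ring
  have hμ1 : μ 1 = betaMeasure (1 - (t + h)) (t + 2 * h) := by
    simp only [hμ]; congr 1; push_cast; ring
  let f : ℝ → ℝ≥0∞ := fun x => ENNReal.ofReal (x ^ n * (1 - x) ^ 2)
  let g : ℝ → ℝ≥0∞ := fun x => ENNReal.ofReal (x ^ 2 * (1 - x) ^ 0)
  have hf : Measurable f := by fun_prop
  have hg : Measurable g := by fun_prop
  have hprod : ∫⁻ Y, f (Y 0) * g (Y 1) ∂Measure.infinitePi μ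
      = (∫⁻ x, f x ∂μ 0) * ∫⁻ x, g x ∂μ 1 := by
    rw [← (measurePreserving_eval_infinitePi μ 0).lintegral_comp hf,
      ← (measurePreserving_eval_infinitePi μ 1).lintegral_comp hg]
    exact lintegral_mul_eq_lintegral_mul_lintegral_of_indepFun
      (hf.comp (measurable_pi_apply 0)) (hg.comp (measurable_pi_apply 1))
      (((iIndepFun_infinitePi (P := μ) (X := fun _ x => x) fun _ => measurable_id).indepFun
        zero_ne_one).comp hf hg)
  have hn (j : ℕ) : 0 < 1 - t + j := by have : (0 : ℝ) ≤ j := j.cast_nonneg; linarith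
  have e : ∏ j ∈ Finset.range n, (1 - h / (1 - t + j))
      = ∏ j ∈ Finset.range n, (1 - (t + h) + j) / (1 - (t + h) + h + j) := by
    refine Finset.prod_congr rfl fun j _ => ?_
    have := hn j
    rw [show 1 - (t + h) + h + j = 1 - t + j by ring]
    field_simp
    ring
  have hP : 0 ≤ ∏ j ∈ Finset.range n, (1 - h / (1 - t + j)) := by
    rw [e]
    exact Finset.prod_nonneg fun j _ => by positivity
  have h0 : ∫⁻ x, f x ∂μ 0 = ENNReal.ofReal (h * ((h + 1) / ((1 - t + n + 1) * (1 - t + n)) *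
      ∏ j ∈ Finset.range n, (1 - h / (1 - t + j)))) := by
    rw [hμ0, lintegral_betaMeasure_pow_mul_pow ha hh, Nat.cast_ofNat,
      show h + 2 = h + 1 + 1 by ring, beta_add_one_right (by positivity) (by positivity),
      beta_add_one_right (by positivity) hh, beta_add_nat_left ha hh, ← e]
    have := (beta_pos ha hh).ne'
    have := (hn n).ne'
    have : 1 - t + n + 1 ≠ 0 := by linarith [hn n]
    rw [show 1 - (t + h) + n + (h + 1) = 1 - t + n + 1 by ring,
      show 1 - (t + h) + n + h = 1 - t + n by ring]
    congr 1
    field_simp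
  have h1 : ∫⁻ x, g x ∂μ 1
      = ENNReal.ofReal ((1 - t - h) * (2 - t - h) / ((1 + h) * (2 + h))) := by
    rw [hμ1, lintegral_betaMeasure_pow_mul_pow ha hb, Nat.cast_zero, add_zero,
      beta_add_nat_left ha hb, mul_div_assoc, div_self (beta_pos ha hb).ne', mul_one,
      Finset.prod_range_succ, Finset.prod_range_one]
    congr 1
    rw [div_mul_div_comm]
    push_cast
    congr 1 <;> ring
  have hA : 0 ≤ (h + 1) / ((1 - t + n + 1) * (1 - t + n)) *
      ∏ j ∈ Finset.range n, (1 - h / (1 - t + j)) := by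
    have := hn n
    positivity
  rw [ENNReal.ofReal_mul hA, ← mul_assoc, ← ENNReal.ofReal_mul hh.le, ← h0, ← h1, ← hprod]
  refine lintegral_mono_ae ?_
  filter_upwards [ae_mem_Ioo_infinitePi_beta ht hh hth] with Y hY
  obtain ⟨hs0, hs0', hs1⟩ := ofSeq_ranked_stickBreaking hY
  have hY0 := (hY 0).1
  have hY1 := (hY 1).1
  have hY0' : 0 < 1 - Y 0 := by linarith [(hY 0).2]
  have hfg : f (Y 0) * g (Y 1)
      = ENNReal.ofReal (Y 0) ^ n * ENNReal.ofReal ((1 - Y 0) * Y 1) ^ 2 := by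
    simp only [f, g]
    rw [← ENNReal.ofReal_mul (by positivity), ← ENNReal.ofReal_pow hY0.le,
      ← ENNReal.ofReal_pow (by positivity), ← ENNReal.ofReal_mul (by positivity)]
    congr 1
    ring
  rw [hfg]
  -- The two sticks are bounded by s₁ and s₂ in an order that depends on which is longer;
  -- distinctness of the two intervals is all that matters.
  rcases le_total (Y 0) ((1 - Y 0) * Y 1) with hle | hle
  · rw [min_eq_left hle] at hs1
    refine le_trans ?_ (le_paintBox_splitPair _ n one_ne_zero)
    gcongr
  · rw [min_eq_right hle] at hs1
    refine le_trans ?_ (le_paintBox_splitPair _ n zero_ne_one)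
    gcongr

end poissonDirichlet

theorem one_sub_sum_le_prod {ι : Type*} (S : Finset ι) (x : ι → ℝ) (h0 : ∀ i ∈ S, 0 ≤ x i)
    (h1 : ∀ i ∈ S, x i ≤ 1) : 1 - ∑ i ∈ S, x i ≤ ∏ i ∈ S, (1 - x i) := by
  classical
  induction S using Finset.induction_on with
  | empty => simp
  | insert a S ha ih =>
    rw [Finset.sum_insert ha, Finset.prod_insert ha]
    have ih := ih (fun i hi => h0 i (Finset.mem_insert_of_mem hi))
      (fun i hi => h1 i (Finset.mem_insert_of_mem hi))
    have ha0 := h0 a (Finset.mem_insert_self a S)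
    have ha1 := h1 a (Finset.mem_insert_self a S)
    have hS : 0 ≤ ∑ i ∈ S, x i :=
      Finset.sum_nonneg fun i hi => h0 i (Finset.mem_insert_of_mem hi)
    nlinarith [mul_le_mul_of_nonneg_left ih (sub_nonneg.2 ha1), mul_nonneg ha0 hS]

/-! ### Bounds on dislocation measures -/

namespace IsDislocationMeasure

variable {t : ℝ} {ν : Measure MassPartition}

/-- Over a time h the one-block partition is left with probability at most ∑ h/(1 - t + j); divide
by h and let h → 0. The erosion part is nonnegative and is dropped. -/
theorem sum_paintBoxMass_le (hν : IsDislocationMeasure t ν) (ht : 0 ≤ t) (ht1 : t < 1) (n : ℕ) :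
    ∑ π ∈ (Finset.univ : Finset (Setoid (Fin n))).erase ⊤, paintBoxMass ν π
      ≤ ENNReal.ofReal (∑ j ∈ Finset.range n, 1 / (1 - t + j)) := by
  obtain ⟨c, hc⟩ := hν.rate
  have hlim := tendsto_finsetSum ((Finset.univ : Finset (Setoid (Fin n))).erase ⊤) fun π hπ =>
    hc n π (Finset.ne_of_mem_erase hπ)
  refine (Finset.sum_le_sum fun π _ => le_self_add).trans (le_of_tendsto hlim ?_)
  have hev : ∀ᶠ h : ℝ in 𝓝[>] 0, h ∈ Ioo 0 (1 - t) :=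
    Ioo_mem_nhdsGT (by linarith)
  filter_upwards [hev] with h hh
  have hth : t + h < 1 := by linarith [hh.2]
  have := isProbabilityMeasure_poissonDirichlet ht hh.1 hth
  have hn (j : ℕ) : 0 < 1 - t + j := by have : (0 : ℝ) ≤ j := j.cast_nonneg; linarith
  have htot : ∑ π : Setoid (Fin n), paintBoxMass (poissonDirichlet (t + h) (-t)) π = 1 := by
    simp only [paintBoxMass]
    rw [← lintegral_finsetSum _ fun π _ => measurable_paintBox π]
    simp [sum_paintBox]
  have htop : ENNReal.ofReal (1 - ∑ j ∈ Finset.range n, h / (1 - t + j))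
      ≤ paintBoxMass (poissonDirichlet (t + h) (-t)) (⊤ : Setoid (Fin n)) := by
    refine le_trans (ENNReal.ofReal_le_ofReal ?_) (le_paintBoxMass_top ht hh.1 hth n)
    refine one_sub_sum_le_prod _ _ (fun j _ => (div_pos hh.1 (hn j)).le) fun j _ => ?_
    rw [div_le_one (hn j)]
    linarith [hh.2, (j.cast_nonneg : (0 : ℝ) ≤ j)]
  rw [← Finset.sum_erase_add _ _ (Finset.mem_univ (⊤ : Setoid (Fin n)))] at htot
  have hle : ∑ π ∈ (Finset.univ : Finset (Setoid (Fin n))).erase ⊤,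
      paintBoxMass (poissonDirichlet (t + h) (-t)) π
      ≤ ENNReal.ofReal (∑ j ∈ Finset.range n, h / (1 - t + j)) := by
    refine (ENNReal.eq_sub_of_add_eq' ENNReal.one_ne_top htot).le.trans ?_
    refine tsub_le_iff_right.2 ?_
    calc (1 : ℝ≥0∞) = ENNReal.ofReal ((∑ j ∈ Finset.range n, h / (1 - t + j)) +
          (1 - ∑ j ∈ Finset.range n, h / (1 - t + j))) := by simp
      _ ≤ _ := ENNReal.ofReal_add_le.trans (by gcongr)
  simp only [div_eq_mul_inv _ (ENNReal.ofReal h)]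
  rw [← Finset.sum_mul, ← div_eq_mul_inv]
  refine ENNReal.div_le_of_le_mul (hle.trans (le_of_eq ?_))
  rw [← ENNReal.ofReal_mul' hh.1.le, Finset.sum_mul]
  congr 1
  exact Finset.sum_congr rfl fun j _ => by ring

/-- By `paintBox_top_le`, 1 - s₁ⁿ is at most the probability that n + 1 points do not form a single
block. -/
theorem lintegral_one_sub_pow_le (hν : IsDislocationMeasure t ν) (ht : 0 ≤ t) (ht1 : t < 1)
    {n : ℕ} (hn : 1 ≤ n) :
    ∫⁻ s, ENNReal.ofReal (1 - s.1 0 ^ n) ∂ν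
      ≤ ENNReal.ofReal (∑ j ∈ Finset.range (n + 1), 1 / (1 - t + j)) := by
  refine le_trans ?_ (hν.sum_paintBoxMass_le ht ht1 (n + 1))
  simp only [paintBoxMass]
  rw [← lintegral_finsetSum _ fun π _ => measurable_paintBox π]
  refine lintegral_mono fun s => ?_
  have h := sum_paintBox s (n + 1)
  rw [← Finset.sum_erase_add _ _ (Finset.mem_univ (⊤ : Setoid (Fin (n + 1))))] at h
  have hle := paintBox_top_le s hn
  rw [ENNReal.ofReal_sub _ (pow_nonneg (s.2.2.1 0) n), ENNReal.ofReal_one,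
    ENNReal.ofReal_pow (s.2.2.1 0), tsub_le_iff_right, ← h]
  gcongr

theorem le_paintBoxMass_splitPair (hν : IsDislocationMeasure t ν) (ht : 0 ≤ t) (ht1 : t < 1 / 2)
    {n : ℕ} (hn : 2 ≤ n) :
    ENNReal.ofReal (3 / 8 / ((n + 1) * (n + 2))) ≤ paintBoxMass ν (splitPair n) := by
  obtain ⟨c, hc⟩ := hν.rate
  have hlim := hc _ _ (splitPair_ne_top (by omega : 1 ≤ n))
  rw [erosionMass_splitPair hn, Nat.cast_zero, mul_zero, add_zero] at hlim
  have hpos (j : ℕ) : 0 < 1 - t + j := by have : (0 : ℝ) ≤ j := j.cast_nonneg; linarith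
  let G : ℝ → ℝ := fun h => (h + 1) / ((1 - t + n + 1) * (1 - t + n)) *
        (∏ j ∈ Finset.range n, (1 - h / (1 - t + j))) *
        ((1 - t - h) * (2 - t - h) / ((1 + h) * (2 + h)))
  have hG : Tendsto (fun h => ENNReal.ofReal (G h)) (𝓝[>] 0) (𝓝 (ENNReal.ofReal (G 0))) := by
    refine ENNReal.tendsto_ofReal (ContinuousAt.tendsto ?_ |>.mono_left nhdsWithin_le_nhds)
    refine ContinuousAt.mul (by fun_prop) (ContinuousAt.div (by fun_prop) (by fun_prop) ?_)
    norm_num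
  have hG0 : 3 / 8 / ((n + 1) * (n + 2)) ≤ G 0 := by
    have h1 := hpos n
    have e : G 0 = (1 - t) * (2 - t) / 2 / ((1 - t + n) * (1 - t + n + 1)) := by
      simp only [G, zero_div, sub_zero, Finset.prod_const_one, zero_add, add_zero]
      field_simp
    rw [e]
    -- The left side is the value of the decreasing right side at t = 1/2.
    have h2 : (3 / 8 : ℝ) ≤ (1 - t) * (2 - t) / 2 := by nlinarith
    have h3 : (1 - t + n) * (1 - t + n + 1) ≤ ((n : ℝ) + 1) * (n + 2) := by nlinarith
    gcongr
  refine (ENNReal.ofReal_le_ofReal hG0).trans (le_of_tendsto_of_tendsto hG hlim ?_)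
  have hev : ∀ᶠ h : ℝ in 𝓝[>] 0, h ∈ Ioo 0 (1 - t) := Ioo_mem_nhdsGT (by linarith)
  filter_upwards [hev] with h hh
  rw [ENNReal.le_div_iff_mul_le (Or.inl (by simpa using hh.1)) (Or.inl ENNReal.ofReal_ne_top),
    mul_comm]
  exact Ruelle.le_paintBoxMass_splitPair ht hh.1 (by linarith [hh.2]) n

end IsDislocationMeasure

/-! ### Logarithmic tail of the second fragment -/

namespace IsDislocationMeasure

variable {t : ℝ} {ν : Measure MassPartition}

theorem measurableSet_lt_second (ε : ℝ) : MeasurableSet {s : MassPartition | ε < s.1 1} :=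
  measurableSet_lt measurable_const (MassPartition.measurable_apply 1)

theorem measure_lt_second_le (hν : IsDislocationMeasure t ν) (ht : 0 ≤ t) (ht1 : t < 1 / 2)
    {L : ℝ} (hL : 0 < L) :
    ν {s | Real.exp (-L) < s.1 1} ≤ ENNReal.ofReal (4 * L + 12) := by
  set n := ⌈Real.exp L⌉₊
  have hexp : 1 < Real.exp L := Real.one_lt_exp_iff.2 hL
  have hn1 : Real.exp L ≤ n := Nat.le_ceil _
  have hn2 : (n : ℝ) < Real.exp L + 1 := Nat.ceil_lt_add_one (by positivity)
  have hnpos : 1 ≤ n := by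
    have : (1 : ℝ) < n := hexp.trans_le hn1
    exact_mod_cast this.le
  have hsum : ∑ j ∈ Finset.range (n + 1), 1 / (1 - t + j) ≤ 2 * (L + 3) := by
    have hH := harmonic_le_one_add_log (n + 1)
    rw [harmonic] at hH
    push_cast at hH
    have hlog : Real.log ((n : ℝ) + 1) ≤ L + 2 := by
      rw [Real.log_le_iff_le_exp (by positivity), Real.exp_add]
      have := Real.add_one_le_exp 2
      nlinarith
    calc ∑ j ∈ Finset.range (n + 1), 1 / (1 - t + j)
        ≤ ∑ j ∈ Finset.range (n + 1), 2 * ((j : ℝ) + 1)⁻¹ := by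
          refine Finset.sum_le_sum fun j _ => ?_
          have hj : (0 : ℝ) ≤ j := j.cast_nonneg
          rw [← div_eq_mul_inv, div_le_div_iff₀ (by linarith) (by positivity)]
          linarith
      _ ≤ 2 * (L + 3) := by
          rw [← Finset.mul_sum]
          linarith
  have hmono : ∀ s : MassPartition, Real.exp (-L) < s.1 1 → 1 / 2 ≤ 1 - s.1 0 ^ n := by
    intro s hs
    -- From s₁ ≤ 1 - s₂ and 1 - x ≤ e^{-x}; raising to a power n ≥ e^L then gives at most e⁻¹ < 1/2.
    have h0 : s.1 0 ≤ Real.exp (-Real.exp (-L)) := by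
      linarith [s.second_le, Real.add_one_le_exp (-Real.exp (-L))]
    have h1 : s.1 0 ^ n ≤ Real.exp (-1) := by
      refine (pow_le_pow_left₀ (s.2.2.1 0) h0 n).trans ?_
      rw [← Real.exp_nat_mul, Real.exp_le_exp, mul_neg, neg_le_neg_iff, Real.exp_neg,
        ← div_eq_mul_inv, one_le_div (by positivity)]
      exact hn1
    linarith [Real.exp_neg_one_lt_half]
  have hmarkov : ENNReal.ofReal (1 / 2) * ν {s | Real.exp (-L) < s.1 1}
      ≤ ∫⁻ s, ENNReal.ofReal (1 - s.1 0 ^ n) ∂ν := by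
    rw [← lintegral_indicator_const (measurableSet_lt_second _)]
    refine lintegral_mono fun s => ?_
    by_cases hs : s ∈ {s : MassPartition | Real.exp (-L) < s.1 1}
    · rw [indicator_of_mem hs]
      exact ENNReal.ofReal_le_ofReal (hmono s hs)
    · rw [indicator_of_notMem hs]
      exact zero_le
  calc ν {s | Real.exp (-L) < s.1 1}
      = ENNReal.ofReal 2 * (ENNReal.ofReal (1 / 2) * ν {s | Real.exp (-L) < s.1 1}) := by
        rw [← mul_assoc, ← ENNReal.ofReal_mul (by norm_num)]
        norm_num
    _ ≤ ENNReal.ofReal 2 * ENNReal.ofReal (2 * (L + 3)) := by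
        gcongr
        exact hmarkov.trans ((hν.lintegral_one_sub_pow_le ht (by linarith) hnpos).trans
          (ENNReal.ofReal_le_ofReal hsum))
    _ = ENNReal.ofReal (4 * L + 12) := by
        rw [← ENNReal.ofReal_mul (by norm_num)]
        congr 1
        ring

theorem le_measure_lt_second (hν : IsDislocationMeasure t ν) (ht : 0 ≤ t) (ht1 : t < 1 / 2)
    {L : ℝ} (hL : 0 < L) :
    ENNReal.ofReal (L / 320 - 2) ≤ ν {s | Real.exp (-L) < s.1 1} := by
  set A := {s : MassPartition | Real.exp (-L) < s.1 1}
  have hfin : ν A ≠ ∞ := ((hν.measure_lt_second_le ht ht1 hL).trans_lt ENNReal.ofReal_lt_top).ne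
  -- Large enough for log(N + 1) ≥ L/2, small enough for N² s₂ ≤ 1 off `A`.
  set N := ⌊Real.exp (L / 2)⌋₊
  have hN1 : (N : ℝ) ≤ Real.exp (L / 2) := Nat.floor_le (by positivity)
  have hN2 : Real.exp (L / 2) < N + 1 := Nat.lt_floor_add_one _
  have hdefect : ∫⁻ s, ENNReal.ofReal (1 - s.1 0) ∂ν ≤ 3 := by
    have h := hν.lintegral_one_sub_pow_le ht (by linarith) le_rfl
    simp only [pow_one] at h
    refine h.trans ?_
    rw [show (3 : ℝ≥0∞) = ENNReal.ofReal 3 by simp]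
    refine ENNReal.ofReal_le_ofReal ?_
    rw [Finset.sum_range_succ, Finset.sum_range_one, Nat.cast_zero, Nat.cast_one]
    have h1 : 1 / (1 - t + 0) ≤ 2 := by
      rw [div_le_iff₀ (by linarith)]
      linarith
    have h2 : 1 / (1 - t + 1) ≤ 1 := by
      rw [div_le_iff₀ (by linarith)]
      linarith
    linarith
  have hrate : ENNReal.ofReal (L / 64) ≤
      ∑ m ∈ Finset.range N, ENNReal.ofReal (m + 1) * paintBoxMass ν (splitPair (m + 2)) := by
    have hlog : L / 2 ≤ Real.log ((N : ℝ) + 1) := by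
      rw [Real.le_log_iff_exp_le (by positivity)]
      exact hN2.le
    have hH := log_add_one_le_harmonic N
    rw [harmonic] at hH
    push_cast at hH
    calc ENNReal.ofReal (L / 64)
        ≤ ENNReal.ofReal (∑ m ∈ Finset.range N,
            (m + 1 : ℝ) * (3 / 8 / (((m + 2 : ℕ) + 1) * ((m + 2 : ℕ) + 2)))) := by
          refine ENNReal.ofReal_le_ofReal ?_
          -- Termwise this is (m + 3)(m + 4) ≤ 12(m + 1)², an equality at m = 0.
          calc L / 64 ≤ 1 / 32 * ∑ m ∈ Finset.range N, ((m : ℝ) + 1)⁻¹ := by linarith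
            _ ≤ _ := by
              rw [Finset.mul_sum]
              refine Finset.sum_le_sum fun m _ => ?_
              push_cast
              rw [div_mul_eq_mul_div, one_mul, ← mul_div_assoc, inv_eq_one_div, div_div,
                div_le_div_iff₀ (by positivity) (by positivity)]
              nlinarith [(m.cast_nonneg : (0 : ℝ) ≤ m)]
      _ = ∑ m ∈ Finset.range N, ENNReal.ofReal (m + 1) *
            ENNReal.ofReal (3 / 8 / (((m + 2 : ℕ) + 1) * ((m + 2 : ℕ) + 2))) := by
          rw [ENNReal.ofReal_sum_of_nonneg fun m _ => by positivity]
          exact Finset.sum_congr rfl fun m _ => ENNReal.ofReal_mul (by positivity)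
      _ ≤ _ := by
          gcongr with m _
          exact hν.le_paintBoxMass_splitPair ht ht1 (by omega)
  have hint : ∑ m ∈ Finset.range N, ENNReal.ofReal (m + 1) * paintBoxMass ν (splitPair (m + 2))
      ≤ 5 * ν A + 2 * 3 := by
    calc _ = ∫⁻ s, ∑ m ∈ Finset.range N,
            ENNReal.ofReal (m + 1) * paintBox s (splitPair (m + 2)) ∂ν := by
          rw [lintegral_finsetSum _ fun m _ => (measurable_paintBox _).const_mul _]
          exact Finset.sum_congr rfl fun m _ =>
            (lintegral_const_mul _ (measurable_paintBox _)).symm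
      _ ≤ ∫⁻ s, (A.indicator (fun _ => 5) s + 2 * ENNReal.ofReal (1 - s.1 0)) ∂ν := by
          refine lintegral_mono fun s => ?_
          by_cases hs : s ∈ A
          · rw [indicator_of_mem hs]
            exact (sum_paintBox_splitPair_le_five s N).trans le_self_add
          · rw [indicator_of_notMem hs, zero_add]
            refine (sum_paintBox_splitPair_le_sq s N).trans ?_
            rw [show (2 : ℝ≥0∞) = ENNReal.ofReal 2 by simp]
            gcongr
            have hs' : s.1 1 ≤ Real.exp (-L) := not_lt.1 hs
            have hNsq : (N : ℝ) ^ 2 ≤ Real.exp L := by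
              calc (N : ℝ) ^ 2 ≤ Real.exp (L / 2) ^ 2 := by gcongr
                _ = Real.exp L := by rw [← Real.exp_nat_mul]; congr 1; push_cast; ring
            calc 2 * (N : ℝ) ^ 2 * s.1 1 ≤ 2 * Real.exp L * Real.exp (-L) := by
                  have := s.2.2.1 1
                  gcongr
              _ = 2 := by rw [mul_assoc, ← Real.exp_add]; simp
      _ ≤ 5 * ν A + 2 * 3 := by
          have hmeas : Measurable fun s : MassPartition => ENNReal.ofReal (1 - s.1 0) :=
            ((MassPartition.measurable_apply 0).const_sub 1).ennreal_ofReal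
          rw [lintegral_add_left (measurable_const.indicator (measurableSet_lt_second _)),
            lintegral_indicator_const (measurableSet_lt_second _),
            lintegral_const_mul 2 hmeas]
          gcongr
  have h := hrate.trans hint
  rw [← ENNReal.ofReal_toReal hfin] at h ⊢
  refine ENNReal.ofReal_le_ofReal ?_
  rw [show (5 : ℝ≥0∞) = ENNReal.ofReal 5 by simp,
    show (2 * 3 : ℝ≥0∞) = ENNReal.ofReal 6 by norm_num, ← ENNReal.ofReal_mul (by norm_num),
    ← ENNReal.ofReal_add (by positivity) (by norm_num),
    ENNReal.ofReal_le_ofReal_iff (by positivity)] at h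
  linarith

end IsDislocationMeasure

/-! ### The record process -/

/-- The atoms that make the record exceed `ε` by time `t`. -/
def exceedSet (t ε : ℝ) : Set (ℝ × MassPartition × ℕ) :=
  {p | p.1 ∈ Icc 0 t ∧ p.2.2 = 0 ∧ ε < p.2.1.1 1}

theorem measurableSet_exceedSet (t ε : ℝ) : MeasurableSet (exceedSet t ε) := by
  refine (measurable_fst measurableSet_Icc).inter (MeasurableSet.inter ?_ ?_)
  · exact (measurable_snd.comp measurable_snd) (measurableSet_singleton 0)
  · exact measurableSet_lt measurable_const
      ((MassPartition.measurable_apply 1).comp (measurable_fst.comp measurable_snd))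

theorem record_le_iff (K : Set (ℝ × MassPartition × ℕ)) (t : ℝ) {ε : ℝ} (hε : 0 ≤ ε) :
    record K t ≤ ε ↔ (K ∩ exceedSet t ε).encard = (0 : ℕ) := by
  rw [Nat.cast_zero, Set.encard_eq_zero, record]
  constructor
  · intro h
    rw [Set.eq_empty_iff_forall_notMem]
    rintro ⟨u, s, k⟩ ⟨hK, hu, hk, hs⟩
    dsimp only at hu hk hs
    subst hk
    have hb : BddAbove {x | ∃ u ∈ Icc 0 t, ∃ s : MassPartition, (u, s, 0) ∈ K ∧ x = s.1 1} := by
      refine ⟨1, ?_⟩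
      rintro x ⟨_, _, s', _, rfl⟩
      exact s'.le_one 1
    exact (hs.trans_le ((le_csSup hb ⟨u, hu, s, hK, rfl⟩).trans h)).false
  · intro h
    -- With no atom the real supremum is 0, hence the need for ε ≥ 0.
    refine Real.sSup_le ?_ hε
    rintro x ⟨u, hu, s, hK, rfl⟩
    by_contra hs
    have : (u, s, 0) ∈ K ∩ exceedSet t ε := ⟨hK, hu, rfl, not_le.1 hs⟩
    rw [h] at this
    exact this

theorem dislocationIntensity_exceedSet (ν : ℝ → Measure MassPartition) {t : ℝ} (ht : t < 1)
    (ε : ℝ) :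
    dislocationIntensity ν (exceedSet t ε) = ∫⁻ u in Icc 0 t, ν u {s | ε < s.1 1} := by
  have h (u : ℝ) : ∑' k : ℕ, ν u {s | (u, s, k) ∈ exceedSet t ε}
      = (Icc 0 t).indicator (fun u => ν u {s | ε < s.1 1}) u := by
    rw [tsum_eq_single 0 fun k hk => by simp [exceedSet, hk]]
    by_cases hu : u ∈ Icc 0 t
    · rw [indicator_of_mem hu]
      congr 1
      ext s
      exact ⟨fun h => h.2.2, fun h => ⟨hu, rfl, h⟩⟩
    · rw [indicator_of_notMem hu]
      refine measure_mono_null (t := ∅) (fun s h => hu h.1) measure_empty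
  have hsub : Icc 0 t ⊆ Ico 0 1 := fun u hu => ⟨hu.1, hu.2.trans_lt ht⟩
  rw [dislocationIntensity, lintegral_congr h, lintegral_indicator measurableSet_Icc,
    Measure.restrict_restrict measurableSet_Icc, inter_eq_left.2 hsub]

theorem IsPoissonMeasure.real_record_le {ν : ℝ → Measure MassPartition} {Ω : Type*}
    [MeasurableSpace Ω] {P : Measure Ω} {K : Ω → Set (ℝ × MassPartition × ℕ)}
    (hK : IsPoissonMeasure P K (dislocationIntensity ν)) {t ε : ℝ} (hε : 0 ≤ ε)
    (hfin : dislocationIntensity ν (exceedSet t ε) ≠ ∞) :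
    P.real {ω | record (K ω) t ≤ ε}
      = Real.exp (-(dislocationIntensity ν (exceedSet t ε)).toReal) := by
  simp only [record_le_iff _ _ hε]
  rw [measureReal_def, hK.law _ (measurableSet_exceedSet t ε) hfin 0, ← measureReal_def,
    poissonMeasure_real_singleton]
  simp [ENNReal.coe_toNNReal_eq_toReal]

end Ruelle

/-! ### Integration of the tail bounds -/

theorem proposition5p6 (T₀ : ℝ) (hT₀ : T₀ ∈ Set.Ioo (0 : ℝ) (1 / 2)) :
    ∃ C₁ C₂ C₃ : ℝ, 0 < C₁ ∧ 0 < C₂ ∧ 0 < C₃ ∧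
      ∀ (ν : ℝ → Measure Ruelle.MassPartition),
        (∀ t ∈ Set.Ico (0 : ℝ) 1, Ruelle.IsDislocationMeasure t (ν t)) →
      ∀ {Ω : Type*} [MeasurableSpace Ω] (P : Measure Ω) [IsProbabilityMeasure P]
        (K : Ω → Set (ℝ × Ruelle.MassPartition × ℕ)),
        Ruelle.IsPoissonMeasure P K (Ruelle.dislocationIntensity ν) →
      ∀ l : ℝ, 0 < l → ∀ t ∈ Set.Ioo (0 : ℝ) T₀,
        Real.exp (-C₁ * l - C₃ * t)
            ≤ P.real {ω | Ruelle.record (K ω) t ≤ Real.exp (-(l / t))} ∧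
          P.real {ω | Ruelle.record (K ω) t ≤ Real.exp (-(l / t))}
            ≤ Real.exp (-C₂ * l + C₃ * t) := by

  -- The tail bounds integrate to l/320 - 2t and 4l + 12t; the 2t is absorbed by 12t.
  refine ⟨4, 1 / 320, 12, by norm_num, by norm_num, by norm_num, ?_⟩
  intro ν hν Ω _ P _ K hK l hl t ht
  have ht0 : 0 < t := ht.1
  have ht2 : t < 1 / 2 := ht.2.trans hT₀.2
  have hL : 0 < l / t := div_pos hl ht0
  have hI := Ruelle.dislocationIntensity_exceedSet ν (by linarith : t < 1) (Real.exp (-(l / t)))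
  have hconst (c : ℝ) : ∫⁻ _ in Set.Icc 0 t, ENNReal.ofReal c = ENNReal.ofReal (c * t) := by
    rw [setLIntegral_const, Real.volume_Icc, sub_zero, ENNReal.ofReal_mul' ht0.le]
  have hupper : Ruelle.dislocationIntensity ν (Ruelle.exceedSet t (Real.exp (-(l / t))))
      ≤ ENNReal.ofReal (4 * l + 12 * t) := by
    rw [hI]
    -- Measurability of u ↦ ν u is not assumed; comparison with constants does not need it.
    refine (setLIntegral_mono' measurableSet_Icc fun u hu =>
      (hν u ⟨hu.1, by linarith [hu.2]⟩).measure_lt_second_le hu.1 (by linarith [hu.2]) hL).trans ?_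
    rw [hconst]
    refine ENNReal.ofReal_le_ofReal (le_of_eq ?_)
    field_simp
  have hlower : ENNReal.ofReal (l / 320 - 2 * t)
      ≤ Ruelle.dislocationIntensity ν (Ruelle.exceedSet t (Real.exp (-(l / t)))) := by
    rw [hI]
    refine le_trans ?_ (setLIntegral_mono' measurableSet_Icc fun u hu =>
      (hν u ⟨hu.1, by linarith [hu.2]⟩).le_measure_lt_second hu.1 (by linarith [hu.2]) hL)
    rw [hconst]
    refine ENNReal.ofReal_le_ofReal (le_of_eq ?_)
    field_simp
  have hfin := (hupper.trans_lt ENNReal.ofReal_lt_top).ne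
  rw [hK.real_record_le (Real.exp_pos _).le hfin, Real.exp_le_exp, Real.exp_le_exp]
  have h1 := ENNReal.toReal_le_of_le_ofReal (by positivity) hupper
  have h2 := (ENNReal.ofReal_le_iff_le_toReal hfin).1 hlower
  constructor <;> linarith
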